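/- Let $\mathcal Y\subset\mathbb R^n$ and $\mathcal Z\subset\mathbb R^p$ be smooth embedded submanifolds (without boundary) of dimensions $k$ and $l$, with surface (Riemannian volume) measures $\mathrm{vol}_{\mathcal Y}$ and $\mathrm{vol}_{\mathcal Z}$, that is, the normalized $k$- and $l$-dimensional Hausdorff measures restricted to $\mathcal Y$ and $\mathcal Z$. Let $U\subset\mathbb R^m$ be open (for instance $U=\mathbb R^m$ or $U=\mathbb R^m\setminus\{0\}$), and let $G:U\to\mathcal Y\times\mathcal Z\subset\mathbb R^n\times\mathbb R^p$ be a smooth bijection with smooth inverse and with $(n+p)\times m$ Jacobian matrix $\nabla G(x)$. Let $\pi$ be a probability density on $U$ with respect to Lebesgue measure, and let $\tilde\pi$ be a probability density on $\mathcal Z$ with respect to $\mathrm{vol}_{\mathcal Z}$ such that $\tilde\pi(z)>0$ for all $z\in\mathcal Z$. If $x\sim\pi$, then the law of $G(x)$ has, with respect to $\mathrm{vol}_{\mathcal Y}\otimes\mathrm{vol}_{\mathcal Z}$, the density $$\pi_{\mathcal Y\times\mathcal Z}(y,z)=\frac{\pi(x)}{\sqrt{\det(\nabla G(x)^\top\nabla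 G(x))}},\qquad x=G^{-1}(y,z),$$ and the law of the $\mathcal Y$-component of $G(x)$ has, with respect to $\mathrm{vol}_{\mathcal Y}$, the density $$\pi_{\mathcal Y}(y)=\mathbb E_{z\sim\tilde\pi}\left[\frac{\pi(x)}{\tilde\pi(z)\,\sqrt{\det(\nabla G(x)^\top\nabla G(x))}}\right],\qquad x=G^{-1}(y,z).$$ Here the expectation is finite for $\mathrm{vol}_{\mathcal Y}$-almost every $y$, it equals $\int_{\mathcal Z}\pi_{\mathcal Y\times\mathcal Z}(y,z)\,d\mathrm{vol}_{\mathcal Z}(z)$ for every $y\in\mathcal Y$ (both integrals being read as $0$ where they diverge), and every density of the law of the $\mathcal Y$-component agrees with it $\mathrm{vol}_{\mathcal Y}$-almost everywhere. -/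

import Mathlib

open MeasureTheory
open scoped ContDiff

/-- `Y` is a smooth embedded submanifold of `ℝⁿ` of dimension `k` (without boundary): around each
of its points there is a smooth chart of `ℝⁿ` that straightens `Y` to a linear subspace of
dimension `k`. -/
def IsEmbeddedSubmanifold {n : ℕ} (k : ℕ) (Y : Set (EuclideanSpace ℝ (Fin n))) : Prop :=
  ∀ y ∈ Y, ∃ (Φ : OpenPartialHomeomorph (EuclideanSpace ℝ (Fin n)) (EuclideanSpace ℝ (Fin n)))
    (W : Submodule ℝ (EuclideanSpace ℝ (Fin n))),
    y ∈ Φ.source ∧ ContDiffOn ℝ ∞ Φ Φ.source ∧ ContDiffOn ℝ ∞ Φ.symm Φ.target ∧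
    Module.finrank ℝ W = k ∧ ∀ x ∈ Φ.source, x ∈ Y ↔ Φ x ∈ W

/-- The volume (surface) measure of a `k`-dimensional embedded submanifold `Y` of `ℝⁿ`, as a measure
on `ℝⁿ` concentrated on `Y`: the `k`-dimensional Hausdorff measure on `Y`, normalized so that it is
Lebesgue measure on `ℝᵏ`. -/
noncomputable def surfaceMeasure {n : ℕ} (k : ℕ) (Y : Set (EuclideanSpace ℝ (Fin n))) :
    Measure (EuclideanSpace ℝ (Fin n)) :=
  (Measure.euclideanHausdorffMeasure k).restrict Y

/-- `G` is a smooth invertible transformation from the set `U` onto `Y × Z`, with smooth inverse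
`Ginv`. The values of `G` off `U` and of `Ginv` off `Y × Z` are irrelevant. -/
structure IsSmoothTransformation {m n p : ℕ}
    (G : EuclideanSpace ℝ (Fin m) → EuclideanSpace ℝ (Fin n) × EuclideanSpace ℝ (Fin p))
    (Ginv : EuclideanSpace ℝ (Fin n) × EuclideanSpace ℝ (Fin p) → EuclideanSpace ℝ (Fin m))
    (U : Set (EuclideanSpace ℝ (Fin m))) (Y : Set (EuclideanSpace ℝ (Fin n)))
    (Z : Set (EuclideanSpace ℝ (Fin p))) : Prop where
  mapsTo : Set.MapsTo G U (Y ×ˢ Z)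
  inv_mapsTo : Set.MapsTo Ginv (Y ×ˢ Z) U
  invOn : Set.InvOn Ginv G U (Y ×ˢ Z)
  smooth : ContDiffOn ℝ ∞ G U
  inv_smooth : ContDiffOn ℝ ∞ Ginv (Y ×ˢ Z)

/-- The `(n + p) × m` Jacobian matrix `∇G(x)` of `G : ℝᵐ → ℝⁿ × ℝᵖ`. -/
noncomputable def jacobianMatrix {m n p : ℕ}
    (G : EuclideanSpace ℝ (Fin m) → EuclideanSpace ℝ (Fin n) × EuclideanSpace ℝ (Fin p))
    (x : EuclideanSpace ℝ (Fin m)) : Matrix (Fin n ⊕ Fin p) (Fin m) ℝ :=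
  Matrix.of fun i j =>
    Sum.elim (fun a => (fderiv ℝ G x (EuclideanSpace.single j 1)).1 a)
      (fun b => (fderiv ℝ G x (EuclideanSpace.single j 1)).2 b) i

/-- `√(det (∇G(x)ᵀ ∇G(x)))`. -/
noncomputable def volumeFactor {m n p : ℕ}
    (G : EuclideanSpace ℝ (Fin m) → EuclideanSpace ℝ (Fin n) × EuclideanSpace ℝ (Fin p))
    (x : EuclideanSpace ℝ (Fin m)) : ℝ :=
  √(((jacobianMatrix G x).transpose * jacobianMatrix G x).det)

/-- The measure with density `f` with respect to `μ`. -/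
noncomputable def densityLaw {α : Type*} [MeasurableSpace α] (μ : Measure α) (f : α → ℝ) :
    Measure α :=
  μ.withDensity fun x => ENNReal.ofReal (f x)

/-- The measure `ν` has density `f` with respect to `μ`. -/
structure HasDensity {α : Type*} [MeasurableSpace α] (ν μ : Measure α) (f : α → ℝ) : Prop where
  aemeasurable : AEMeasurable f μ
  ae_nonneg : ∀ᵐ x ∂μ, 0 ≤ f x
  eq_densityLaw : ν = densityLaw μ f

/-- `f` is a probability density on `S` with respect to the measure `μ`, which is meant to be
concentrated on `S`. The values of `f` off `S` are irrelevant. -/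
structure IsProbDensityOn {α : Type*} [MeasurableSpace α] (S : Set α) (μ : Measure α)
    (f : α → ℝ) : Prop where
  aemeasurable : AEMeasurable f μ
  nonneg : ∀ x ∈ S, 0 ≤ f x
  isProbabilityMeasure : IsProbabilityMeasure (densityLaw μ f)

/-- The density `π(x) / √(det (∇G(x)ᵀ ∇G(x)))`, `x = G⁻¹(y, z)`, corresponding to `π` on `Y × Z`. -/
noncomputable def transformedDensity {m n p : ℕ}
    (G : EuclideanSpace ℝ (Fin m) → EuclideanSpace ℝ (Fin n) × EuclideanSpace ℝ (Fin p))
    (Ginv : EuclideanSpace ℝ (Fin n) × EuclideanSpace ℝ (Fin p) → EuclideanSpace ℝ (Fin m))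
    (ρ : EuclideanSpace ℝ (Fin m) → ℝ)
    (q : EuclideanSpace ℝ (Fin n) × EuclideanSpace ℝ (Fin p)) : ℝ :=
  ρ (Ginv q) / volumeFactor G (Ginv q)

/-- The quantity `π(x) / (π̃(z) √(det (∇G(x)ᵀ ∇G(x))))`, `x = G⁻¹(y, z)`, that is averaged over
`z ∼ π̃`. -/
noncomputable def importanceRatio {m n p : ℕ}
    (G : EuclideanSpace ℝ (Fin m) → EuclideanSpace ℝ (Fin n) × EuclideanSpace ℝ (Fin p))
    (Ginv : EuclideanSpace ℝ (Fin n) × EuclideanSpace ℝ (Fin p) → EuclideanSpace ℝ (Fin m))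
    (ρ : EuclideanSpace ℝ (Fin m) → ℝ) (ρt : EuclideanSpace ℝ (Fin p) → ℝ)
    (y : EuclideanSpace ℝ (Fin n)) (z : EuclideanSpace ℝ (Fin p)) : ℝ :=
  ρ (Ginv (y, z)) / (ρt z * volumeFactor G (Ginv (y, z)))

/-! Everything rests on one change of variables, `map_withDensity_volumeFactor`: the product of the
surface measures is the image under `G` of Lebesgue measure on `U` weighted by `volumeFactor G`. The
weight is positive and `G` is invertible, so a density `ρ` on `U` becomes `ρ` divided by the weight,
read at `Ginv`. Fubini then gives the marginal on `Y`, and in the expectation the positive factor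
`ρt` cancels against the density of the sampling law.

The change of variables is local. Given parametrizations `φ` of `Y` and `ψ` of `Z`, the map `h =
Ginv ∘ (φ × ψ)` parametrizes an open piece of `U`. The area formula
`euclideanHausdorffMeasure_restrict_image_eq_map` expresses both surface measures and Lebesgue
measure through the norm determinants of the derivatives of `φ`, `ψ` and `h`. The chain rule for `G
∘ h = φ × ψ` (`volumeFactor_mul_normDet`) shows that the weight is exactly what converts one into
the other, and a countable cover glues the pieces.

The area formula reduces to linear maps: near a point, an immersion distorts distances, compared
with its derivative there, by a factor at most `c`, for any `c > 1`. Hausdorff measures of images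
therefore agree up to a power of `c`, and `c` tends to 1. -/

open Set Filter Topology Module
open scoped NNReal ENNReal

/-! ### Local-to-global principles for measures. -/

section LocalComparison

variable {X : Type*} [TopologicalSpace X] [SecondCountableTopology X] [MeasurableSpace X]
  [OpensMeasurableSpace X]

/-- Second countability gives a countable subcover, which is then made disjoint. Nonemptiness allows
the centres to be indexed by `ℕ`. -/
theorem Set.exists_disjoint_measurable_cover_of_open_nhds {S : Set X} {N : X → Set X}
    (hN : ∀ x ∈ S, IsOpen (N x) ∧ x ∈ N x) (hS : S.Nonempty) :
    ∃ (f : ℕ → X) (D : ℕ → Set X), (∀ i, f i ∈ S) ∧ (∀ i, D i ⊆ N (f i)) ∧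
      (∀ i, MeasurableSet (D i)) ∧ Pairwise (Function.onFun Disjoint D) ∧ S ⊆ ⋃ i, D i := by
  obtain ⟨t, htS, htc, htU⟩ := TopologicalSpace.countable_cover_nhdsWithin (f := N) (s := S)
    fun x hx => mem_nhdsWithin_of_mem_nhds ((hN x hx).1.mem_nhds (hN x hx).2)
  have htne : t.Nonempty := by
    obtain ⟨x, hx⟩ := hS
    obtain ⟨y, hy, -⟩ := mem_iUnion₂.1 (htU hx)
    exact ⟨y, hy⟩
  obtain ⟨f, rfl⟩ := htc.exists_eq_range htne
  have hf : ∀ i, f i ∈ S := fun i => htS (mem_range_self i)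
  refine ⟨f, disjointed fun i => N (f i), hf, fun i => disjointed_subset _ i,
    fun i => MeasurableSet.disjointed (fun j => (hN _ (hf j)).1.measurableSet) i,
    disjoint_disjointed _, ?_⟩
  rw [iUnion_disjointed]
  simpa using htU

/-- Inequality of measures is a local property. -/
theorem MeasureTheory.Measure.le_of_locally_le {α β : Measure X} {S : Set X} (hα : α Sᶜ = 0)
    (h : ∀ x ∈ S, ∃ N, IsOpen N ∧ x ∈ N ∧ ∀ A ⊆ N, MeasurableSet A → α A ≤ β A) : α ≤ β := by
  rcases S.eq_empty_or_nonempty with rfl | hS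
  · rw [compl_empty, Measure.measure_univ_eq_zero] at hα
    rw [hα]
    exact Measure.zero_le β
  choose! N hNo hxN hle using h
  obtain ⟨f, D, hf, hDN, hDm, hDd, hSD⟩ :=
    Set.exists_disjoint_measurable_cover_of_open_nhds (fun x hx => ⟨hNo x hx, hxN x hx⟩) hS
  refine Measure.le_iff.2 fun A hA => ?_
  have hd : Pairwise (Function.onFun Disjoint fun i => A ∩ D i) := fun i j hij =>
    (hDd hij).mono inter_subset_right inter_subset_right
  have hm : ∀ i, MeasurableSet (A ∩ D i) := fun i => hA.inter (hDm i)
  -- `S` need not be measurable, so its null complement is added to the cover instead of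
  -- intersecting with `S`.
  calc α A ≤ α ((⋃ i, A ∩ D i) ∪ Sᶜ) := measure_mono fun x hx => by
        by_cases hxS : x ∈ S
        · left; rw [← inter_iUnion]; exact ⟨hx, hSD hxS⟩
        · exact Or.inr hxS
    _ ≤ α (⋃ i, A ∩ D i) + α Sᶜ := measure_union_le _ _
    _ = ∑' i, α (A ∩ D i) := by rw [hα, add_zero, measure_iUnion hd hm]
    _ ≤ ∑' i, β (A ∩ D i) := ENNReal.tsum_le_tsum fun i =>
        hle _ (hf i) _ (inter_subset_right.trans (hDN i)) (hm i)
    _ = β (⋃ i, A ∩ D i) := (measure_iUnion hd hm).symm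
    _ ≤ β A := measure_mono (iUnion_subset fun i => inter_subset_left)

/-- Equality of measures is a local property. -/
theorem MeasureTheory.Measure.ext_of_locally_restrict_eq {α β : Measure X} {S : Set X}
    (hα : α Sᶜ = 0) (hβ : β Sᶜ = 0)
    (h : ∀ x ∈ S, ∃ N, IsOpen N ∧ x ∈ N ∧ α.restrict N = β.restrict N) : α = β := by
  have key : ∀ x ∈ S, ∃ N, IsOpen N ∧ x ∈ N ∧ ∀ A ⊆ N, MeasurableSet A → α A = β A := by
    intro x hx
    obtain ⟨N, hN, hxN, heq⟩ := h x hx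
    refine ⟨N, hN, hxN, fun A hA hAm => ?_⟩
    rw [← Measure.restrict_eq_self α hA, heq, Measure.restrict_eq_self β hA]
  apply le_antisymm
  · refine Measure.le_of_locally_le hα fun x hx => ?_
    obtain ⟨N, hN, hxN, hle⟩ := key x hx
    exact ⟨N, hN, hxN, fun A hA hAm => (hle A hA hAm).le⟩
  · refine Measure.le_of_locally_le hβ fun x hx => ?_
    obtain ⟨N, hN, hxN, hle⟩ := key x hx
    exact ⟨N, hN, hxN, fun A hA hAm => (hle A hA hAm).ge⟩

/-- S-finiteness is a local property. -/
theorem MeasureTheory.Measure.sFinite_of_locally_sFinite {α : Measure X} {S : Set X}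
    (hα : α Sᶜ = 0) (h : ∀ x ∈ S, ∃ N, IsOpen N ∧ x ∈ N ∧ SFinite (α.restrict N)) :
    SFinite α := by
  rcases S.eq_empty_or_nonempty with rfl | hS
  · rw [compl_empty, Measure.measure_univ_eq_zero] at hα
    rw [hα]
    infer_instance
  choose! N hNo hxN hfin using h
  obtain ⟨f, D, hf, hDN, hDm, hDd, hSD⟩ :=
    Set.exists_disjoint_measurable_cover_of_open_nhds (fun x hx => ⟨hNo x hx, hxN x hx⟩) hS
  have h1 : α.restrict (⋃ i, D i) = α :=
    Measure.restrict_eq_self_of_ae_mem (measure_mono_null (compl_subset_compl.2 hSD) hα)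
  have h2 : ∀ i, SFinite (α.restrict (D i)) := fun i => by
    have := hfin _ (hf i)
    rw [← Measure.restrict_restrict_of_subset (hDN i)]
    infer_instance
  rw [← h1, Measure.restrict_iUnion hDd hDm]
  infer_instance

end LocalComparison

/-! ### The area formula for injective immersions. -/

section AreaFormula

/-- The relation `f ∘ g⁻¹` is a well-defined `c`-Lipschitz map on `g '' A`: points with equal `g`
have equal `f` by the hypothesis, so any choice of preimages serves. -/
theorem euclideanHausdorffMeasure_image_le_of_edist_le {X E F : Type*}
    [EMetricSpace E] [MeasurableSpace E] [BorelSpace E]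
    [EMetricSpace F] [MeasurableSpace F] [BorelSpace F] {f : X → E} {g : X → F} {A : Set X}
    {c : ℝ≥0} (h : ∀ u ∈ A, ∀ v ∈ A, edist (f u) (f v) ≤ c * edist (g u) (g v)) (d : ℕ) :
    μHE[d] (f '' A) ≤ (c : ℝ≥0∞) ^ d * μHE[d] (g '' A) := by
  rcases A.eq_empty_or_nonempty with rfl | ⟨a, -⟩
  · simp
  have : Nonempty X := ⟨a⟩
  set r := Function.invFunOn g A
  have hr : ∀ u ∈ A, r (g u) ∈ A ∧ g (r (g u)) = g u := fun u hu =>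
    Function.invFunOn_pos ⟨u, hu, rfl⟩
  have himg : (fun y => f (r y)) '' (g '' A) = f '' A := by
    rw [image_image]
    refine image_congr fun u hu => ?_
    have := h _ (hr u hu).1 u hu
    rw [(hr u hu).2, edist_self, mul_zero] at this
    exact edist_eq_zero.1 (le_antisymm this bot_le)
  have hlip : LipschitzOnWith c (fun y => f (r y)) (g '' A) := by
    rintro _ ⟨u, hu, rfl⟩ _ ⟨v, hv, rfl⟩
    have := h _ (hr u hu).1 _ (hr v hv).1
    rwa [(hr u hu).2, (hr v hv).2] at this
  have := hlip.hausdorffMeasure_image_le (d := d) (Nat.cast_nonneg d)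
  rw [himg, ENNReal.rpow_natCast] at this
  simp_rw [Measure.euclideanHausdorffMeasure_def, Measure.smul_apply, Measure.nnreal_smul_coe_apply]
  rw [mul_left_comm]
  gcongr

variable {E F : Type*} [NormedAddCommGroup E] [InnerProductSpace ℝ E] [FiniteDimensional ℝ E]
  [NormedAddCommGroup F] [InnerProductSpace ℝ F]

/-- In finite dimension an injective `f'` is bounded below, so the strict differentiability error,
small relative to `‖u - v‖`, is also small relative to `‖f' (u - v)‖`. -/
theorem HasStrictFDerivAt.eventually_edist_le {f : E → F} {f' : E →L[ℝ] F} {x : E}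
    (hf : HasStrictFDerivAt f f' x) (hinj : Function.Injective f') {c : ℝ≥0} (hc : 1 < c) :
    ∃ N ∈ 𝓝 x, ∀ u ∈ N, ∀ v ∈ N, edist (f u) (f v) ≤ c * edist (f' u) (f' v) ∧
      edist (f' u) (f' v) ≤ c * edist (f u) (f v) := by
  obtain ⟨K, hK0, hK⟩ := f'.toLinearMap.exists_antilipschitzWith (LinearMap.ker_eq_bot.2 hinj)
  have hc' : (1 : ℝ) < c := by exact_mod_cast hc
  have hK0' : (0 : ℝ) < K := by exact_mod_cast hK0
  -- With this `δ` the error is at most `(1 - 1/c) ‖f' (u - v)‖`. The lower bound on `‖f u - f v‖`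
  -- is then exactly `‖f' (u - v)‖ / c`, and the upper bound follows from `1 - 1/c ≤ c - 1`.
  set δ : ℝ := (c - 1) / (c * K) with hδ
  have hδ0 : 0 < δ := by have := sub_pos.2 hc'; positivity
  have hev := hf.isLittleO.def hδ0
  rw [nhds_prod_eq] at hev
  obtain ⟨N, hN, hNN⟩ := (Filter.eventually_prod_self_iff
    (r := fun u v => ‖f u - f v - f' (u - v)‖ ≤ δ * ‖u - v‖)).1 hev
  refine ⟨N, hN, fun u hu v hv => ?_⟩
  have h1 : ‖f u - f v - f' (u - v)‖ ≤ δ * ‖u - v‖ := hNN u hu v hv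
  have h2 : ‖u - v‖ ≤ K * ‖f' (u - v)‖ := by
    have := hK.le_mul_dist u v
    rw [dist_eq_norm, dist_eq_norm] at this
    simpa using this
  have h3 : δ * ‖u - v‖ ≤ (c - 1) / c * ‖f' (u - v)‖ := by
    calc δ * ‖u - v‖ ≤ δ * (K * ‖f' (u - v)‖) := by gcongr
      _ = _ := by rw [hδ]; field_simp
  have hn := norm_nonneg (f' (u - v))
  have hcinv : (c - 1 : ℝ) / c ≤ c - 1 := div_le_self (by linarith) hc'.le
  have e1 : edist (f u) (f v) = ENNReal.ofReal ‖f u - f v‖ := by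
    rw [edist_dist, dist_eq_norm]
  have e2 : edist (f' u) (f' v) = ENNReal.ofReal ‖f' (u - v)‖ := by
    rw [edist_dist, dist_eq_norm, map_sub]
  have e3 : (c : ℝ≥0∞) = ENNReal.ofReal c := by simp
  rw [e1, e2, e3, ← ENNReal.ofReal_mul c.coe_nonneg, ← ENNReal.ofReal_mul c.coe_nonneg]
  constructor <;> refine ENNReal.ofReal_le_ofReal ?_
  · have := norm_sub_norm_le (f u - f v) (f' (u - v))
    nlinarith
  · have h4 := norm_sub_norm_le (f' (u - v)) (f u - f v)
    rw [norm_sub_rev (f' (u - v))] at h4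
    have h5 : ‖f' (u - v)‖ * (1 / c) ≤ ‖f u - f v‖ := by
      have : (c - 1 : ℝ) / c = 1 - 1 / c := by field_simp
      rw [this] at h3
      nlinarith
    rw [mul_one_div, div_le_iff₀ (by linarith)] at h5
    linarith

/-- The norm determinant is the square root of a Gram determinant, whose entries depend continuously
on `f`. -/
theorem continuous_normDet : Continuous fun f : E →L[ℝ] F => f.toLinearMap.normDet := by
  have h : (fun f : E →L[ℝ] F => f.toLinearMap.normDet) = fun f : E →L[ℝ] F =>
      √(Matrix.gram ℝ (f <| stdOrthonormalBasis ℝ E ·)).det := by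
    funext f
    have := LinearMap.normDet_sq_eq_det_gram f.toLinearMap (stdOrthonormalBasis ℝ E)
    simp only [RCLike.ofReal_real_eq_id, id] at this
    rw [← Real.sqrt_sq f.toLinearMap.normDet_nonneg, this]
    rfl
  rw [h]
  refine Real.continuous_sqrt.comp (Continuous.matrix_det ?_)
  refine continuous_matrix fun i j => ?_
  simp only [Matrix.gram_apply]
  fun_prop

theorem normDet_pos_of_injective {f : E →L[ℝ] F} (hf : Function.Injective f) :
    0 < f.toLinearMap.normDet := by
  refine lt_of_le_of_ne (LinearMap.normDet_nonneg _) fun h => ?_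
  exact LinearMap.normDet_eq_zero_iff_ker_ne_bot.1 h.symm (LinearMap.ker_eq_bot.2 hf)

variable [MeasurableSpace E] [BorelSpace E] [MeasurableSpace F] [BorelSpace F]

/-- The measure of the image of a set under an immersion is, on small sets, close to the integral
of the Jacobian. -/
theorem exists_nhds_euclideanHausdorffMeasure_image_le {f : E → F} {V : Set E} (hV : IsOpen V)
    (hf : ContDiffOn ℝ 1 f V) {x : E} (hx : x ∈ V) (hinj : Function.Injective (fderiv ℝ f x))
    {c : ℝ≥0} (hc : 1 < c) :
    ∃ N, IsOpen N ∧ x ∈ N ∧ N ⊆ V ∧ ∀ A ⊆ N, MeasurableSet A →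
      μHE[finrank ℝ E] (f '' A) ≤ (c : ℝ≥0∞) ^ (finrank ℝ E + 1) *
        ∫⁻ u in A, ENNReal.ofReal (fderiv ℝ f u).toLinearMap.normDet ∧
      ∫⁻ u in A, ENNReal.ofReal (fderiv ℝ f u).toLinearMap.normDet ≤
        (c : ℝ≥0∞) ^ (finrank ℝ E + 1) * μHE[finrank ℝ E] (f '' A) := by
  have hfx : ContDiffAt ℝ 1 f x := hf.contDiffAt (hV.mem_nhds hx)
  obtain ⟨N₁, hN₁, hed⟩ :=
    (hfx.hasStrictFDerivAt one_ne_zero).eventually_edist_le hinj hc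
  set J : E → ℝ := fun u => (fderiv ℝ f u).toLinearMap.normDet with hJ
  have hJc : ContinuousAt J x :=
    continuous_normDet.continuousAt.comp
      ((hf.continuousOn_fderiv_of_isOpen hV le_rfl).continuousAt (hV.mem_nhds hx))
  have hJpos : 0 < J x := normDet_pos_of_injective hinj
  have hc' : (1 : ℝ) < c := by exact_mod_cast hc
  -- Freezing the Jacobian at `x` costs one factor `c`, and replacing `f` by its derivative at `x`
  -- costs `c ^ finrank ℝ E`; hence the exponent `finrank ℝ E + 1`.
  have hev1 : ∀ᶠ u in 𝓝 x, J u < c * J x := hJc.eventually_lt_const (by nlinarith)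
  have hev2 : ∀ᶠ u in 𝓝 x, J x < c * J u :=
    (hJc.const_mul (c : ℝ)).eventually_const_lt (by nlinarith)
  obtain ⟨N, hNsub, hNo, hxN⟩ := mem_nhds_iff.1
    (Filter.inter_mem (Filter.inter_mem hN₁ (hV.mem_nhds hx)) (hev1.and hev2))
  refine ⟨N, hNo, hxN, fun u hu => (hNsub hu).1.2, fun A hA hAm => ?_⟩
  have hlin := LinearMap.euclideanHausdorffMeasure_image_eq_normDet_mul_volume
    (fderiv ℝ f x).toLinearMap A
  have e3 : (c : ℝ≥0∞) = ENNReal.ofReal c := by simp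
  constructor
  · calc μHE[finrank ℝ E] (f '' A)
        ≤ (c : ℝ≥0∞) ^ finrank ℝ E * μHE[finrank ℝ E] (fderiv ℝ f x '' A) :=
          euclideanHausdorffMeasure_image_le_of_edist_le
            (fun u hu v hv => (hed u (hNsub (hA hu)).1.1 v (hNsub (hA hv)).1.1).1) _
      _ = (c : ℝ≥0∞) ^ finrank ℝ E * ∫⁻ _ in A, ENNReal.ofReal (J x) := by
          rw [setLIntegral_const]; exact congrArg _ hlin
      _ ≤ (c : ℝ≥0∞) ^ finrank ℝ E * ∫⁻ u in A, c * ENNReal.ofReal (J u) := by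
          refine mul_le_mul_right (setLIntegral_mono' hAm fun u hu => ?_) _
          rw [e3, ← ENNReal.ofReal_mul c.coe_nonneg]
          exact ENNReal.ofReal_le_ofReal (hNsub (hA hu)).2.2.le
      _ = _ := by
          rw [lintegral_const_mul' _ _ ENNReal.coe_ne_top, ← mul_assoc, pow_succ]
  · calc ∫⁻ u in A, ENNReal.ofReal (J u)
        ≤ ∫⁻ _ in A, c * ENNReal.ofReal (J x) := by
          refine setLIntegral_mono' hAm fun u hu => ?_
          rw [e3, ← ENNReal.ofReal_mul c.coe_nonneg]
          exact ENNReal.ofReal_le_ofReal (hNsub (hA hu)).2.1.le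
      _ = c * μHE[finrank ℝ E] (fderiv ℝ f x '' A) := by
          rw [setLIntegral_const, mul_assoc]; exact congrArg _ hlin.symm
      _ ≤ c * ((c : ℝ≥0∞) ^ finrank ℝ E * μHE[finrank ℝ E] (f '' A)) := by
          refine mul_le_mul_right (euclideanHausdorffMeasure_image_le_of_edist_le
            (fun u hu v hv => (hed u (hNsub (hA hu)).1.1 v (hNsub (hA hv)).1.1).2) _) _
      _ = _ := by rw [← mul_assoc, pow_succ']

theorem ENNReal.le_of_forall_one_lt_le_pow_mul {a b : ℝ≥0∞} (d : ℕ)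
    (h : ∀ c : ℝ≥0, 1 < c → a ≤ (c : ℝ≥0∞) ^ d * b) : a ≤ b := by
  have hlim : Tendsto (fun c : ℝ≥0 => (c : ℝ≥0∞) ^ d * b) (𝓝[>] 1) (𝓝 (1 * b)) := by
    refine ENNReal.Tendsto.mul_const ?_ (Or.inl one_ne_zero)
    have : Continuous fun c : ℝ≥0 => (c : ℝ≥0∞) ^ d := by fun_prop
    have h1 := this.tendsto 1
    simp only [ENNReal.coe_one, one_pow] at h1
    exact h1.mono_left nhdsWithin_le_nhds
  rw [one_mul] at hlim
  exact ge_of_tendsto hlim (eventually_nhdsWithin_of_forall h)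

/-- The **area formula** for injective immersions. -/
theorem euclideanHausdorffMeasure_restrict_image_eq_map {f : E → F} {V : Set E} (hV : IsOpen V)
    (hf : ContDiffOn ℝ 1 f V) (hinj : InjOn f V)
    (himm : ∀ x ∈ V, Function.Injective (fderiv ℝ f x)) :
    (μHE[finrank ℝ E]).restrict (f '' V) = ((volume.restrict V).withDensity fun x =>
      ENNReal.ofReal (fderiv ℝ f x).toLinearMap.normDet).map f := by
  have hemb : MeasurableEmbedding (V.domRestrict f) :=
    hf.continuousOn.measurableEmbedding hV.measurableSet hinj
  -- The Hausdorff measure of the image, pulled back to the domain. It is a measure because `f`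
  -- restricted to `V` is a measurable embedding.
  set ν : Measure E := ((μHE[finrank ℝ E]).comap (V.domRestrict f)).map Subtype.val with hν
  set β : Measure E := (volume.restrict V).withDensity fun x =>
      ENNReal.ofReal (fderiv ℝ f x).toLinearMap.normDet with hβ
  have hνA : ∀ A, MeasurableSet A → ν A = μHE[finrank ℝ E] (f '' (A ∩ V)) := by
    intro A hA
    rw [hν, Measure.map_apply measurable_subtype_coe hA, hemb.comap_apply]
    congr 1
    ext y
    simp only [mem_image, mem_preimage, mem_inter_iff, Subtype.exists, Set.domRestrict_apply]
    grind
  have hβA : ∀ A, MeasurableSet A → A ⊆ V → β A =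
      ∫⁻ u in A, ENNReal.ofReal (fderiv ℝ f u).toLinearMap.normDet := by
    intro A hA hAV
    rw [hβ, withDensity_apply _ hA, Measure.restrict_restrict hA, inter_eq_left.2 hAV]
  have hνV : ν Vᶜ = 0 := by rw [hνA _ hV.measurableSet.compl]; simp
  have hβV : β Vᶜ = 0 := by
    rw [hβ]
    exact withDensity_absolutelyContinuous _ _ (by simp [Measure.restrict_apply, hV.measurableSet])
  have key : ν = β := by
    apply le_antisymm
    · refine Measure.le_iff.2 fun A hA =>
        ENNReal.le_of_forall_one_lt_le_pow_mul (finrank ℝ E + 1) fun c hc => ?_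
      have : ν ≤ ((c : ℝ≥0∞) ^ (finrank ℝ E + 1)) • β := by
        refine Measure.le_of_locally_le hνV fun x hx => ?_
        obtain ⟨N, hN, hxN, hNV, hle⟩ :=
          exists_nhds_euclideanHausdorffMeasure_image_le hV hf hx (himm x hx) hc
        refine ⟨N, hN, hxN, fun B hB hBm => ?_⟩
        rw [hνA B hBm, Measure.smul_apply, hβA B hBm (hB.trans hNV),
          inter_eq_left.2 (hB.trans hNV)]
        exact (hle B hB hBm).1
      simpa using this A
    · refine Measure.le_iff.2 fun A hA =>
        ENNReal.le_of_forall_one_lt_le_pow_mul (finrank ℝ E + 1) fun c hc => ?_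
      have : β ≤ ((c : ℝ≥0∞) ^ (finrank ℝ E + 1)) • ν := by
        refine Measure.le_of_locally_le hβV fun x hx => ?_
        obtain ⟨N, hN, hxN, hNV, hle⟩ :=
          exists_nhds_euclideanHausdorffMeasure_image_le hV hf hx (himm x hx) hc
        refine ⟨N, hN, hxN, fun B hB hBm => ?_⟩
        rw [Measure.smul_apply, hνA B hBm, hβA B hBm (hB.trans hNV),
          inter_eq_left.2 (hB.trans hNV)]
        exact (hle B hB hBm).2
      simpa using this A
  have hae : AEMeasurable f β :=
    (hf.continuousOn.aemeasurable hV.measurableSet).mono_ac (withDensity_absolutelyContinuous _ _)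
  ext B hB
  rw [← key] at hae ⊢
  rw [Measure.map_apply_of_aemeasurable hae hB, Measure.restrict_apply hB]
  -- Nothing is known about `f` off `V`, so `f ⁻¹' B` may fail to be measurable; it is replaced by a
  -- measurable set with the same trace on `V`, where `ν` is concentrated.
  obtain ⟨T, hT, hTV⟩ : ∃ T, MeasurableSet T ∧ f ⁻¹' B ∩ V = T ∩ V := by
    refine ⟨f ⁻¹' B ∩ V, ?_, by simp [inter_assoc]⟩
    have := (MeasurableEmbedding.subtype_coe hV.measurableSet).measurableSet_image.2
      (hemb.measurable hB)
    convert this using 1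
    ext y
    simp only [mem_image, mem_preimage, mem_inter_iff, Subtype.exists, Set.domRestrict_apply]
    grind
  have hνae : ∀ᵐ x ∂ν, x ∈ V := hνV
  have h1 : ν (f ⁻¹' B) = ν T := by
    refine measure_congr ?_
    filter_upwards [hνae] with x hx
    have : x ∈ f ⁻¹' B ∩ V ↔ x ∈ T ∩ V := by rw [hTV]
    simp only [mem_inter_iff, hx, and_true] at this
    exact propext this
  rw [h1, hνA T hT, ← hTV, inter_comm (f ⁻¹' B) V, image_inter_preimage, inter_comm]

end AreaFormula

/-! ### Norm determinants of maps into products. -/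

section NormDet

variable {E F₁ F₂ : Type*} [NormedAddCommGroup E] [InnerProductSpace ℝ E] [FiniteDimensional ℝ E]
  [NormedAddCommGroup F₁] [InnerProductSpace ℝ F₁]
  [NormedAddCommGroup F₂] [InnerProductSpace ℝ F₂]

/-- The norm determinant of a linear map to `F₁ × F₂`, with respect to the Euclidean (`L²`) structure
of the product. -/
noncomputable def prodNormDet (T : E →L[ℝ] F₁ × F₂) : ℝ :=
  (((WithLp.prodContinuousLinearEquiv 2 ℝ F₁ F₂).symm : F₁ × F₂ →L[ℝ] WithLp 2 (F₁ × F₂)) ∘L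
    T).toLinearMap.normDet

theorem prodNormDet_nonneg (T : E →L[ℝ] F₁ × F₂) : 0 ≤ prodNormDet T :=
  LinearMap.normDet_nonneg _

theorem continuous_prodNormDet : Continuous (prodNormDet : (E →L[ℝ] F₁ × F₂) → ℝ) :=
  continuous_normDet.comp (continuous_const.clm_comp continuous_id)

theorem prodNormDet_sq {ι : Type*} [Fintype ι] [DecidableEq ι] (T : E →L[ℝ] F₁ × F₂)
    (b : OrthonormalBasis ι ℝ E) : prodNormDet T ^ 2 = (Matrix.of fun i j =>
      inner ℝ (T (b i)).1 (T (b j)).1 + inner ℝ (T (b i)).2 (T (b j)).2).det := by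
  have h := LinearMap.normDet_sq_eq_det_gram
    (((WithLp.prodContinuousLinearEquiv 2 ℝ F₁ F₂).symm : F₁ × F₂ →L[ℝ] WithLp 2 (F₁ × F₂)) ∘L
      T).toLinearMap b
  simp only [RCLike.ofReal_real_eq_id, id] at h
  rw [prodNormDet, h]
  rfl

theorem prodNormDet_comp {E' : Type*} [NormedAddCommGroup E'] [InnerProductSpace ℝ E']
    [FiniteDimensional ℝ E'] (T : E →L[ℝ] F₁ × F₂) (S : E' →L[ℝ] E)
    (h : finrank ℝ E' = finrank ℝ E) :
    prodNormDet (T ∘L S) = prodNormDet T * S.toLinearMap.normDet := by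
  rw [prodNormDet, prodNormDet, ← LinearMap.normDet_comp_of_finrank_eq _ _ h]
  rfl

/-- In the product of two orthonormal bases the Gram matrix is block diagonal, with the Gram
matrices of `A` and `B` as blocks. -/
theorem prodNormDet_prodMap {E₁ E₂ : Type*}
    [NormedAddCommGroup E₁] [InnerProductSpace ℝ E₁] [FiniteDimensional ℝ E₁]
    [NormedAddCommGroup E₂] [InnerProductSpace ℝ E₂] [FiniteDimensional ℝ E₂]
    (A : E₁ →L[ℝ] F₁) (B : E₂ →L[ℝ] F₂) :
    prodNormDet ((A.prodMap B) ∘L (WithLp.prodContinuousLinearEquiv 2 ℝ E₁ E₂ :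
        WithLp 2 (E₁ × E₂) →L[ℝ] E₁ × E₂)) =
      A.toLinearMap.normDet * B.toLinearMap.normDet := by
  rw [← sq_eq_sq₀ (prodNormDet_nonneg _)
    (mul_nonneg (LinearMap.normDet_nonneg _) (LinearMap.normDet_nonneg _)), mul_pow]
  set b₁ := stdOrthonormalBasis ℝ E₁
  set b₂ := stdOrthonormalBasis ℝ E₂
  have h₁ := LinearMap.normDet_sq_eq_det_gram A.toLinearMap b₁
  have h₂ := LinearMap.normDet_sq_eq_det_gram B.toLinearMap b₂
  simp only [RCLike.ofReal_real_eq_id, id] at h₁ h₂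
  rw [prodNormDet_sq _ (b₁.prod b₂), h₁, h₂, ← Matrix.det_fromBlocks_zero₁₂ _ 0]
  congr 1
  ext i j
  rcases i with i | i <;> rcases j with j | j <;> simp [Matrix.gram_apply]

/-- `∇Gᵀ∇G` is the Gram matrix of the images of the standard basis under the derivative. -/
theorem volumeFactor_eq_prodNormDet {m n p : ℕ}
    (G : EuclideanSpace ℝ (Fin m) → EuclideanSpace ℝ (Fin n) × EuclideanSpace ℝ (Fin p))
    (x : EuclideanSpace ℝ (Fin m)) : volumeFactor G x = prodNormDet (fderiv ℝ G x) := by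
  have h : prodNormDet (fderiv ℝ G x) ^ 2 =
      ((jacobianMatrix G x).transpose * jacobianMatrix G x).det := by
    rw [prodNormDet_sq _ (EuclideanSpace.basisFun (Fin m) ℝ)]
    congr 1
    ext i j
    simp only [Matrix.of_apply, EuclideanSpace.basisFun_apply, Matrix.mul_apply,
      Matrix.transpose_apply, jacobianMatrix, Fintype.sum_sum_type, Sum.elim_inl, Sum.elim_inr,
      PiLp.inner_apply, RCLike.inner_apply, conj_trivial]
    exact congrArg₂ _ (Finset.sum_congr rfl fun _ _ => mul_comm _ _)
      (Finset.sum_congr rfl fun _ _ => mul_comm _ _)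
  rw [volumeFactor, ← h, Real.sqrt_sq (prodNormDet_nonneg _)]

end NormDet

/-! ### Densities of image measures. -/

section MapDensity

variable {α β : Type*} [MeasurableSpace α] [MeasurableSpace β]

theorem MeasureTheory.Measure.withDensity_map {μ : Measure α} {h : α → β} {g : β → ℝ≥0∞}
    (hh : AEMeasurable h μ) (hg : AEMeasurable g (μ.map h)) :
    (μ.map h).withDensity g = (μ.withDensity (g ∘ h)).map h := by
  ext s hs
  rw [withDensity_apply _ hs, Measure.map_apply_of_aemeasurable
    (hh.mono_ac (withDensity_absolutelyContinuous _ _)) hs,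
    withDensity_apply₀ _ (hh.nullMeasurableSet_preimage hs),
    Measure.restrict_map_of_aemeasurable hh hs, lintegral_map' _ hh.restrict]
  · rfl
  · rw [← Measure.restrict_map_of_aemeasurable hh hs]
    exact hg.restrict

end MapDensity

/-! ### Local parametrizations. -/

section Parametrization

variable {E F : Type*} [NormedAddCommGroup E] [InnerProductSpace ℝ E] [MeasurableSpace E]
  [NormedAddCommGroup F] [InnerProductSpace ℝ F] [MeasurableSpace F]

/-- `φ` is a smooth parametrization of `Y ∩ N` by the open set `V`, and `q` is a smooth map on the
open set `N` that restricts to its inverse. -/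
structure IsLocalParametrization (Y N : Set F) (V : Set E) (φ : E → F) (q : F → E) : Prop where
  isOpen_target : IsOpen N
  isOpen_source : IsOpen V
  measurable : Measurable φ
  contDiffOn : ContDiffOn ℝ ∞ φ V
  contDiffOn_inv : ContDiffOn ℝ ∞ q N
  mapsTo : ∀ w ∈ V, φ w ∈ Y ∩ N
  left_inv : ∀ w ∈ V, q (φ w) = w
  inv_mapsTo : ∀ x ∈ Y ∩ N, q x ∈ V
  right_inv : ∀ x ∈ Y ∩ N, φ (q x) = x

namespace IsLocalParametrization

variable {Y N : Set F} {V : Set E} {φ : E → F} {q : F → E}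

theorem image_eq (h : IsLocalParametrization Y N V φ q) : φ '' V = Y ∩ N := by
  ext x
  constructor
  · rintro ⟨w, hw, rfl⟩
    exact h.mapsTo w hw
  · exact fun hx => ⟨q x, h.inv_mapsTo x hx, h.right_inv x hx⟩

theorem injOn (h : IsLocalParametrization Y N V φ q) : InjOn φ V :=
  LeftInvOn.injOn (f₁' := q) h.left_inv

theorem differentiableAt (h : IsLocalParametrization Y N V φ q) {w : E} (hw : w ∈ V) :
    DifferentiableAt ℝ φ w :=
  (h.contDiffOn.contDiffAt (h.isOpen_source.mem_nhds hw)).differentiableAt (by simp)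

theorem differentiableAt_inv (h : IsLocalParametrization Y N V φ q) {x : F} (hx : x ∈ N) :
    DifferentiableAt ℝ q x :=
  (h.contDiffOn_inv.contDiffAt (h.isOpen_target.mem_nhds hx)).differentiableAt (by simp)

theorem measurableSet [FiniteDimensional ℝ E] [BorelSpace E] [BorelSpace F]
    (h : IsLocalParametrization Y N V φ q) : MeasurableSet (Y ∩ N) := by
  rw [← h.image_eq]
  exact h.isOpen_source.measurableSet.image_of_continuousOn_injOn h.contDiffOn.continuousOn h.injOn

end IsLocalParametrization

/-- By the chain rule the derivative of `g` is a left inverse of the derivative of `f`. -/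
theorem fderiv_injective_of_eventually_leftInverse {E F : Type*}
    [NormedAddCommGroup E] [NormedSpace ℝ E] [NormedAddCommGroup F] [NormedSpace ℝ F]
    {f : E → F} {g : F → E} {x : E} (hf : DifferentiableAt ℝ f x) (hg : DifferentiableAt ℝ g (f x))
    (h : ∀ᶠ y in 𝓝 x, g (f y) = y) : Function.Injective (fderiv ℝ f x) := by
  have h1 : fderiv ℝ (g ∘ f) x = ContinuousLinearMap.id ℝ E := by
    rw [Filter.EventuallyEq.fderiv_eq (f₁ := g ∘ f) (f := id) h, fderiv_id]
  rw [fderiv_comp x hg hf] at h1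
  exact Function.LeftInverse.injective (g := fderiv ℝ g (f x)) fun v => congr($h1 v)

theorem IsLocalParametrization.fderiv_injective {Y N : Set F} {V : Set E} {φ : E → F} {q : F → E}
    (h : IsLocalParametrization Y N V φ q) {w : E} (hw : w ∈ V) :
    Function.Injective (fderiv ℝ φ w) :=
  fderiv_injective_of_eventually_leftInverse (h.differentiableAt hw)
    (h.differentiableAt_inv (h.mapsTo w hw).2)
    (Filter.eventually_of_mem (h.isOpen_source.mem_nhds hw) h.left_inv)

end Parametrization

/-! ### Embedded submanifolds and their surface measures. -/

section Submanifold

variable {n k : ℕ} {Y : Set (EuclideanSpace ℝ (Fin n))}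

/-- The inverse of a straightening chart, restricted to `W`, parametrizes `Y`. Following the chart
by orthogonal projection onto `W` extends the inverse smoothly to an open set of the ambient space.
-/
theorem IsEmbeddedSubmanifold.exists_isLocalParametrization (hY : IsEmbeddedSubmanifold k Y)
    {y : EuclideanSpace ℝ (Fin n)} (hy : y ∈ Y) :
    ∃ (W : Submodule ℝ (EuclideanSpace ℝ (Fin n))) (N : Set (EuclideanSpace ℝ (Fin n)))
      (V : Set W) (φ : W → EuclideanSpace ℝ (Fin n)) (q : EuclideanSpace ℝ (Fin n) → W),
      y ∈ N ∧ finrank ℝ W = k ∧ IsLocalParametrization Y N V φ q := by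
  classical
  obtain ⟨Φ, W, hyΦ, hΦ, hΦs, hW, hmem⟩ := hY y hy
  set V : Set W := (fun w : W => (w : EuclideanSpace ℝ (Fin n))) ⁻¹' Φ.target with hV
  have hVo : IsOpen V := Φ.open_target.preimage continuous_subtype_val
  -- Extension by zero makes `φ` measurable on all of `W`.
  set φ : W → EuclideanSpace ℝ (Fin n) := V.indicator fun w => Φ.symm w with hφ
  have hφV : ∀ w ∈ V, φ w = Φ.symm w := fun w hw => indicator_of_mem hw _
  have hφc : ContDiffOn ℝ ∞ (fun w : W => Φ.symm w) V :=
    hΦs.comp W.subtypeL.contDiff.contDiffOn fun w hw => hw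
  have hproj : ∀ w : W, W.orthogonalProjectionOnto (w : EuclideanSpace ℝ (Fin n)) = w := by
    intro w; simp
  refine ⟨W, Φ.source, V, φ, fun x => W.orthogonalProjectionOnto (Φ x), hyΦ, hW,
    Φ.open_source, hVo, ?_, hφc.congr hφV, ?_, ?_, ?_, ?_, ?_⟩
  · exact hφc.continuousOn.measurable_piecewise continuousOn_const hVo.measurableSet
  · exact (W.orthogonalProjectionOnto).contDiff.comp_contDiffOn hΦ
  · intro w hw
    rw [hφV w hw]
    have hs := Φ.map_target hw
    refine ⟨(hmem _ hs).2 ?_, hs⟩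
    rw [Φ.right_inv hw]
    exact w.2
  · intro w hw
    rw [hφV w hw, Φ.right_inv hw, hproj]
  · rintro x ⟨hxY, hxs⟩
    have hxW := (hmem x hxs).1 hxY
    have := hproj ⟨Φ x, hxW⟩
    rw [this]
    exact Φ.map_source hxs
  · rintro x ⟨hxY, hxs⟩
    have hxW := (hmem x hxs).1 hxY
    have := hproj ⟨Φ x, hxW⟩
    rw [this, hφV _ (Φ.map_source hxs)]
    exact Φ.left_inv hxs

/-- `Y` need not be closed, but locally it is an injective continuous image of an open set, hence
Borel, and countably many such pieces cover it. -/
theorem IsEmbeddedSubmanifold.measurableSet (hY : IsEmbeddedSubmanifold k Y) : MeasurableSet Y := by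
  rcases Y.eq_empty_or_nonempty with rfl | hne
  · exact MeasurableSet.empty
  have h : ∀ y ∈ Y, ∃ N, IsOpen N ∧ y ∈ N ∧ MeasurableSet (Y ∩ N) := fun y hy => by
    obtain ⟨W, N, V, φ, q, hyN, -, h⟩ := hY.exists_isLocalParametrization hy
    exact ⟨N, h.isOpen_target, hyN, h.measurableSet⟩
  choose! N hN hyN hm using h
  obtain ⟨f, D, hf, hDN, hDm, -, hSD⟩ :=
    Set.exists_disjoint_measurable_cover_of_open_nhds (fun x hx => ⟨hN x hx, hyN x hx⟩) hne
  have : Y = ⋃ i, (Y ∩ N (f i)) ∩ D i := by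
    refine subset_antisymm (fun x hx => ?_) (iUnion_subset fun i x hx => hx.1.1)
    obtain ⟨i, hi⟩ := mem_iUnion.1 (hSD hx)
    exact mem_iUnion.2 ⟨i, ⟨hx, hDN i hi⟩, hi⟩
  rw [this]
  exact MeasurableSet.iUnion fun i => (hm _ (hf i)).inter (hDm i)

/-- The surface measure in a local parametrization. -/
theorem IsLocalParametrization.surfaceMeasure_restrict {E : Type*} [NormedAddCommGroup E]
    [InnerProductSpace ℝ E] [FiniteDimensional ℝ E] [MeasurableSpace E] [BorelSpace E]
    {N : Set (EuclideanSpace ℝ (Fin n))} {V : Set E} {φ : E → EuclideanSpace ℝ (Fin n)}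
    {q : EuclideanSpace ℝ (Fin n) → E} (h : IsLocalParametrization Y N V φ q)
    (hk : finrank ℝ E = k) :
    (surfaceMeasure k Y).restrict N = ((volume.restrict V).withDensity fun x =>
      ENNReal.ofReal (fderiv ℝ φ x).toLinearMap.normDet).map φ := by
  rw [surfaceMeasure, Measure.restrict_restrict h.isOpen_target.measurableSet, inter_comm,
    ← h.image_eq, ← hk]
  exact euclideanHausdorffMeasure_restrict_image_eq_map h.isOpen_source
    (h.contDiffOn.of_le (by simp)) h.injOn fun x hx => h.fderiv_injective hx

theorem IsEmbeddedSubmanifold.surfaceMeasure_compl (hY : IsEmbeddedSubmanifold k Y) :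
    surfaceMeasure k Y Yᶜ = 0 := by
  rw [surfaceMeasure, Measure.restrict_apply hY.measurableSet.compl]
  simp

/-- Needed for product measures and Fubini; locally the surface measure is the image of a measure
with a density with respect to Lebesgue measure. -/
theorem IsEmbeddedSubmanifold.sFinite_surfaceMeasure (hY : IsEmbeddedSubmanifold k Y) :
    SFinite (surfaceMeasure k Y) := by
  refine Measure.sFinite_of_locally_sFinite hY.surfaceMeasure_compl fun y hy => ?_
  obtain ⟨W, N, V, φ, q, hyN, hk, h⟩ := hY.exists_isLocalParametrization hy
  refine ⟨N, h.isOpen_target, hyN, ?_⟩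
  rw [h.surfaceMeasure_restrict hk]
  infer_instance

end Submanifold

/-! ### The change of variables in local parametrizations. -/

section Transformation

variable {m n p k l : ℕ} {U : Set (EuclideanSpace ℝ (Fin m))}
  {Y : Set (EuclideanSpace ℝ (Fin n))} {Z : Set (EuclideanSpace ℝ (Fin p))}
  {G : EuclideanSpace ℝ (Fin m) → EuclideanSpace ℝ (Fin n) × EuclideanSpace ℝ (Fin p)}
  {Ginv : EuclideanSpace ℝ (Fin n) × EuclideanSpace ℝ (Fin p) → EuclideanSpace ℝ (Fin m)}

namespace IsSmoothTransformation

theorem differentiableAt (hG : IsSmoothTransformation G Ginv U Y Z)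
    (hU : IsOpen U) {x : EuclideanSpace ℝ (Fin m)} (hx : x ∈ U) : DifferentiableAt ℝ G x :=
  (hG.smooth.contDiffAt (hU.mem_nhds hx)).differentiableAt (by simp)

theorem continuousOn_volumeFactor (hG : IsSmoothTransformation G Ginv U Y Z) (hU : IsOpen U) :
    ContinuousOn (volumeFactor G) U := by
  rw [funext (volumeFactor_eq_prodNormDet G)]
  exact continuous_prodNormDet.comp_continuousOn
    (hG.smooth.continuousOn_fderiv_of_isOpen hU (by simp))

theorem aemeasurable (hG : IsSmoothTransformation G Ginv U Y Z)
    (hU : IsOpen U) : AEMeasurable G (volume.restrict U) :=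
  hG.smooth.continuousOn.aemeasurable hU.measurableSet

theorem aemeasurable_volumeFactor (hG : IsSmoothTransformation G Ginv U Y Z) (hU : IsOpen U) :
    AEMeasurable (volumeFactor G) (volume.restrict U) :=
  (hG.continuousOn_volumeFactor hU).aemeasurable hU.measurableSet

end IsSmoothTransformation

section Local

variable {E₁ E₂ : Type*}
  [NormedAddCommGroup E₁] [InnerProductSpace ℝ E₁] [MeasurableSpace E₁]
  [NormedAddCommGroup E₂] [InnerProductSpace ℝ E₂] [MeasurableSpace E₂]
  {N : Set (EuclideanSpace ℝ (Fin n))} {V : Set E₁}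
  {φ : E₁ → EuclideanSpace ℝ (Fin n)} {q : EuclideanSpace ℝ (Fin n) → E₁}
  {N' : Set (EuclideanSpace ℝ (Fin p))} {V' : Set E₂}
  {ψ : E₂ → EuclideanSpace ℝ (Fin p)} {q' : EuclideanSpace ℝ (Fin p) → E₂}

theorem IsLocalParametrization.aemeasurable_normDet [FiniteDimensional ℝ E₁] [BorelSpace E₁]
    (hφ : IsLocalParametrization Y N V φ q) :
    AEMeasurable (fun x => ENNReal.ofReal (fderiv ℝ φ x).toLinearMap.normDet)
      (volume.restrict V) :=
  ((continuous_normDet.comp_continuousOn (hφ.contDiffOn.continuousOn_fderiv_of_isOpen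
    hφ.isOpen_source (by simp))).aemeasurable hφ.isOpen_source.measurableSet).ennreal_ofReal

/-- The product of the surface measures in local parametrizations. -/
theorem IsLocalParametrization.surfaceMeasure_prod_restrict
    [FiniteDimensional ℝ E₁] [BorelSpace E₁] [FiniteDimensional ℝ E₂] [BorelSpace E₂]
    (hφ : IsLocalParametrization Y N V φ q) (hψ : IsLocalParametrization Z N' V' ψ q')
    (hk : finrank ℝ E₁ = k) (hl : finrank ℝ E₂ = l)
    [SFinite (surfaceMeasure k Y)] [SFinite (surfaceMeasure l Z)] :
    ((surfaceMeasure k Y).prod (surfaceMeasure l Z)).restrict (N ×ˢ N') =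
      ((volume.restrict (V ×ˢ V')).withDensity fun w =>
        ENNReal.ofReal (fderiv ℝ φ w.1).toLinearMap.normDet *
          ENNReal.ofReal (fderiv ℝ ψ w.2).toLinearMap.normDet).map (Prod.map φ ψ) := by
  rw [← Measure.prod_restrict, hφ.surfaceMeasure_restrict hk, hψ.surfaceMeasure_restrict hl,
    Measure.map_prod_map _ _ hφ.measurable hψ.measurable,
    prod_withDensity₀ hφ.aemeasurable_normDet hψ.aemeasurable_normDet,
    Measure.prod_restrict, Measure.volume_eq_prod]

/-- The parametrization of an open subset of `U` by the parameters of `Y` and `Z`. -/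
noncomputable def pullbackParametrization
    (Ginv : EuclideanSpace ℝ (Fin n) × EuclideanSpace ℝ (Fin p) → EuclideanSpace ℝ (Fin m))
    (φ : E₁ → EuclideanSpace ℝ (Fin n)) (ψ : E₂ → EuclideanSpace ℝ (Fin p))
    (w : WithLp 2 (E₁ × E₂)) : EuclideanSpace ℝ (Fin m) :=
  Ginv (Prod.map φ ψ (WithLp.prodContinuousLinearEquiv 2 ℝ E₁ E₂ w))

/-- The inverse of `pullbackParametrization`. -/
noncomputable def pullbackChart
    (G : EuclideanSpace ℝ (Fin m) → EuclideanSpace ℝ (Fin n) × EuclideanSpace ℝ (Fin p))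
    (q : EuclideanSpace ℝ (Fin n) → E₁) (q' : EuclideanSpace ℝ (Fin p) → E₂)
    (x : EuclideanSpace ℝ (Fin m)) : WithLp 2 (E₁ × E₂) :=
  (WithLp.prodContinuousLinearEquiv 2 ℝ E₁ E₂).symm (Prod.map q q' (G x))

namespace IsSmoothTransformation

theorem isOpen_inter_preimage (hG : IsSmoothTransformation G Ginv U Y Z) (hU : IsOpen U)
    (hφ : IsLocalParametrization Y N V φ q) (hψ : IsLocalParametrization Z N' V' ψ q') :
    IsOpen (U ∩ G ⁻¹' (N ×ˢ N')) :=
  hG.smooth.continuousOn.isOpen_inter_preimage hU (hφ.isOpen_target.prod hψ.isOpen_target)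

theorem _root_.IsLocalParametrization.isOpen_preimage_prod (hφ : IsLocalParametrization Y N V φ q)
    (hψ : IsLocalParametrization Z N' V' ψ q') :
    IsOpen (WithLp.prodContinuousLinearEquiv 2 ℝ E₁ E₂ ⁻¹' (V ×ˢ V')) :=
  (hφ.isOpen_source.prod hψ.isOpen_source).preimage
    (WithLp.prodContinuousLinearEquiv 2 ℝ E₁ E₂).continuous

variable {w : WithLp 2 (E₁ × E₂)}

theorem apply_pullbackParametrization (hG : IsSmoothTransformation G Ginv U Y Z)
    (hφ : IsLocalParametrization Y N V φ q) (hψ : IsLocalParametrization Z N' V' ψ q')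
    (hw : w ∈ WithLp.prodContinuousLinearEquiv 2 ℝ E₁ E₂ ⁻¹' (V ×ˢ V')) :
    G (pullbackParametrization Ginv φ ψ w) =
      Prod.map φ ψ (WithLp.prodContinuousLinearEquiv 2 ℝ E₁ E₂ w) :=
  hG.invOn.2 ⟨(hφ.mapsTo _ hw.1).1, (hψ.mapsTo _ hw.2).1⟩

theorem pullbackParametrization_mem (hG : IsSmoothTransformation G Ginv U Y Z)
    (hφ : IsLocalParametrization Y N V φ q) (hψ : IsLocalParametrization Z N' V' ψ q')
    (hw : w ∈ WithLp.prodContinuousLinearEquiv 2 ℝ E₁ E₂ ⁻¹' (V ×ˢ V')) :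
    pullbackParametrization Ginv φ ψ w ∈ U ∩ G ⁻¹' (N ×ˢ N') := by
  refine ⟨hG.inv_mapsTo ⟨(hφ.mapsTo _ hw.1).1, (hψ.mapsTo _ hw.2).1⟩, ?_⟩
  rw [mem_preimage, hG.apply_pullbackParametrization hφ hψ hw]
  exact ⟨(hφ.mapsTo _ hw.1).2, (hψ.mapsTo _ hw.2).2⟩

theorem pullbackChart_pullbackParametrization (hG : IsSmoothTransformation G Ginv U Y Z)
    (hφ : IsLocalParametrization Y N V φ q) (hψ : IsLocalParametrization Z N' V' ψ q')
    (hw : w ∈ WithLp.prodContinuousLinearEquiv 2 ℝ E₁ E₂ ⁻¹' (V ×ˢ V')) :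
    pullbackChart G q q' (pullbackParametrization Ginv φ ψ w) = w := by
  rw [pullbackChart, hG.apply_pullbackParametrization hφ hψ hw,
    ContinuousLinearEquiv.symm_apply_eq]
  exact Prod.ext (hφ.left_inv _ hw.1) (hψ.left_inv _ hw.2)

theorem pullbackChart_mem (hG : IsSmoothTransformation G Ginv U Y Z)
    (hφ : IsLocalParametrization Y N V φ q) (hψ : IsLocalParametrization Z N' V' ψ q')
    {x : EuclideanSpace ℝ (Fin m)} (hx : x ∈ U ∩ G ⁻¹' (N ×ˢ N')) :
    pullbackChart G q q' x ∈ WithLp.prodContinuousLinearEquiv 2 ℝ E₁ E₂ ⁻¹' (V ×ˢ V') := by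
  rw [mem_preimage, pullbackChart, ContinuousLinearEquiv.apply_symm_apply]
  exact ⟨hφ.inv_mapsTo _ ⟨(hG.mapsTo hx.1).1, hx.2.1⟩, hψ.inv_mapsTo _ ⟨(hG.mapsTo hx.1).2, hx.2.2⟩⟩

theorem pullbackParametrization_pullbackChart (hG : IsSmoothTransformation G Ginv U Y Z)
    (hφ : IsLocalParametrization Y N V φ q) (hψ : IsLocalParametrization Z N' V' ψ q')
    {x : EuclideanSpace ℝ (Fin m)} (hx : x ∈ U ∩ G ⁻¹' (N ×ˢ N')) :
    pullbackParametrization Ginv φ ψ (pullbackChart G q q' x) = x := by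
  rw [pullbackParametrization, pullbackChart, ContinuousLinearEquiv.apply_symm_apply]
  have : Prod.map φ ψ (Prod.map q q' (G x)) = G x :=
    Prod.ext (hφ.right_inv _ ⟨(hG.mapsTo hx.1).1, hx.2.1⟩)
      (hψ.right_inv _ ⟨(hG.mapsTo hx.1).2, hx.2.2⟩)
  rw [this]
  exact hG.invOn.1 hx.1

theorem image_pullbackParametrization (hG : IsSmoothTransformation G Ginv U Y Z)
    (hφ : IsLocalParametrization Y N V φ q) (hψ : IsLocalParametrization Z N' V' ψ q') :
    pullbackParametrization Ginv φ ψ '' (WithLp.prodContinuousLinearEquiv 2 ℝ E₁ E₂ ⁻¹' (V ×ˢ V')) =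
      U ∩ G ⁻¹' (N ×ˢ N') := by
  ext x
  constructor
  · rintro ⟨w, hw, rfl⟩
    exact hG.pullbackParametrization_mem hφ hψ hw
  · exact fun hx => ⟨_, hG.pullbackChart_mem hφ hψ hx,
      hG.pullbackParametrization_pullbackChart hφ hψ hx⟩

theorem injOn_pullbackParametrization (hG : IsSmoothTransformation G Ginv U Y Z)
    (hφ : IsLocalParametrization Y N V φ q) (hψ : IsLocalParametrization Z N' V' ψ q') :
    InjOn (pullbackParametrization Ginv φ ψ)
      (WithLp.prodContinuousLinearEquiv 2 ℝ E₁ E₂ ⁻¹' (V ×ˢ V')) :=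
  LeftInvOn.injOn (f₁' := pullbackChart G q q') fun _ hw =>
    hG.pullbackChart_pullbackParametrization hφ hψ hw

/-- `Ginv` is smooth only within `Y ×ˢ Z`, which need not be open, but `φ × ψ` maps an open set into
`Y ×ˢ Z`, so the composite is smooth in the ordinary sense. -/
theorem contDiffOn_pullbackParametrization (hG : IsSmoothTransformation G Ginv U Y Z)
    (hφ : IsLocalParametrization Y N V φ q) (hψ : IsLocalParametrization Z N' V' ψ q') :
    ContDiffOn ℝ ∞ (pullbackParametrization Ginv φ ψ)
      (WithLp.prodContinuousLinearEquiv 2 ℝ E₁ E₂ ⁻¹' (V ×ˢ V')) := by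
  refine hG.inv_smooth.comp (t := Y ×ˢ Z)
    ((hφ.contDiffOn.prodMap hψ.contDiffOn).comp
    (WithLp.prodContinuousLinearEquiv 2 ℝ E₁ E₂).contDiff.contDiffOn fun w hw => hw) fun w hw =>
    ⟨(hφ.mapsTo _ hw.1).1, (hψ.mapsTo _ hw.2).1⟩

theorem differentiableAt_pullbackParametrization (hG : IsSmoothTransformation G Ginv U Y Z)
    (hφ : IsLocalParametrization Y N V φ q) (hψ : IsLocalParametrization Z N' V' ψ q')
    (hw : w ∈ WithLp.prodContinuousLinearEquiv 2 ℝ E₁ E₂ ⁻¹' (V ×ˢ V')) :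
    DifferentiableAt ℝ (pullbackParametrization Ginv φ ψ) w :=
  ((hG.contDiffOn_pullbackParametrization hφ hψ).contDiffAt
    ((hφ.isOpen_preimage_prod hψ).mem_nhds hw)).differentiableAt (by simp)

theorem differentiableAt_pullbackChart (hG : IsSmoothTransformation G Ginv U Y Z) (hU : IsOpen U)
    (hφ : IsLocalParametrization Y N V φ q) (hψ : IsLocalParametrization Z N' V' ψ q')
    {x : EuclideanSpace ℝ (Fin m)} (hx : x ∈ U ∩ G ⁻¹' (N ×ˢ N')) :
    DifferentiableAt ℝ (pullbackChart G q q') x := by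
  have h := hG.differentiableAt hU hx.1
  exact (WithLp.prodContinuousLinearEquiv 2 ℝ E₁ E₂).symm.differentiableAt.comp x
    (((hφ.differentiableAt_inv hx.2.1).comp x h.fst).prodMk
      ((hψ.differentiableAt_inv hx.2.2).comp x h.snd))

theorem fderiv_pullbackParametrization_injective (hG : IsSmoothTransformation G Ginv U Y Z)
    (hU : IsOpen U)
    (hφ : IsLocalParametrization Y N V φ q) (hψ : IsLocalParametrization Z N' V' ψ q')
    (hw : w ∈ WithLp.prodContinuousLinearEquiv 2 ℝ E₁ E₂ ⁻¹' (V ×ˢ V')) :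
    Function.Injective (fderiv ℝ (pullbackParametrization Ginv φ ψ) w) :=
  fderiv_injective_of_eventually_leftInverse (g := pullbackChart G q q')
    (hG.differentiableAt_pullbackParametrization hφ hψ hw)
    (hG.differentiableAt_pullbackChart hU hφ hψ (hG.pullbackParametrization_mem hφ hψ hw))
    (Filter.eventually_of_mem ((hφ.isOpen_preimage_prod hψ).mem_nhds hw)
      fun _ h => hG.pullbackChart_pullbackParametrization hφ hψ h)

theorem fderiv_pullbackChart_injective (hG : IsSmoothTransformation G Ginv U Y Z) (hU : IsOpen U)
    (hφ : IsLocalParametrization Y N V φ q) (hψ : IsLocalParametrization Z N' V' ψ q')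
    {x : EuclideanSpace ℝ (Fin m)} (hx : x ∈ U ∩ G ⁻¹' (N ×ˢ N')) :
    Function.Injective (fderiv ℝ (pullbackChart G q q') x) :=
  fderiv_injective_of_eventually_leftInverse (g := pullbackParametrization Ginv φ ψ)
    (hG.differentiableAt_pullbackChart hU hφ hψ hx)
    (hG.differentiableAt_pullbackParametrization hφ hψ (hG.pullbackChart_mem hφ hψ hx))
    (Filter.eventually_of_mem ((hG.isOpen_inter_preimage hU hφ hψ).mem_nhds hx)
      fun _ h => hG.pullbackParametrization_pullbackChart hφ hψ h)

variable [FiniteDimensional ℝ E₁] [FiniteDimensional ℝ E₂]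

/-- The relation between `m` and the dimensions of `Y` and `Z` is not assumed: it follows from the
injectivity of the derivatives of two mutually inverse maps at a point, which `w` provides. -/
theorem finrank_eq (hG : IsSmoothTransformation G Ginv U Y Z) (hU : IsOpen U)
    (hφ : IsLocalParametrization Y N V φ q) (hψ : IsLocalParametrization Z N' V' ψ q')
    (hw : w ∈ WithLp.prodContinuousLinearEquiv 2 ℝ E₁ E₂ ⁻¹' (V ×ˢ V')) :
    finrank ℝ (WithLp 2 (E₁ × E₂)) = finrank ℝ (EuclideanSpace ℝ (Fin m)) :=
  le_antisymm
    (LinearMap.finrank_le_finrank_of_injective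
      (hG.fderiv_pullbackParametrization_injective hU hφ hψ hw))
    (LinearMap.finrank_le_finrank_of_injective
      (hG.fderiv_pullbackChart_injective hU hφ hψ (hG.pullbackParametrization_mem hφ hψ hw)))

/-- The chain rule for volume factors. -/
theorem volumeFactor_mul_normDet (hG : IsSmoothTransformation G Ginv U Y Z) (hU : IsOpen U)
    (hφ : IsLocalParametrization Y N V φ q) (hψ : IsLocalParametrization Z N' V' ψ q')
    (hw : w ∈ WithLp.prodContinuousLinearEquiv 2 ℝ E₁ E₂ ⁻¹' (V ×ˢ V')) :
    volumeFactor G (pullbackParametrization Ginv φ ψ w) *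
      (fderiv ℝ (pullbackParametrization Ginv φ ψ) w).toLinearMap.normDet =
      (fderiv ℝ φ w.fst).toLinearMap.normDet * (fderiv ℝ ψ w.snd).toLinearMap.normDet := by
  rw [volumeFactor_eq_prodNormDet, ← prodNormDet_comp _ _ (hG.finrank_eq hU hφ hψ hw),
    ← prodNormDet_prodMap]
  congr 1
  have hd := hG.differentiableAt_pullbackParametrization hφ hψ hw
  have hdG := hG.differentiableAt hU (hG.pullbackParametrization_mem hφ hψ hw).1
  have h2 : HasFDerivAt (Prod.map φ ψ) ((fderiv ℝ φ w.fst).prodMap (fderiv ℝ ψ w.snd))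
      (WithLp.prodContinuousLinearEquiv 2 ℝ E₁ E₂ w) :=
    HasFDerivAt.prodMap _ (hφ.differentiableAt hw.1).hasFDerivAt
      (hψ.differentiableAt hw.2).hasFDerivAt
  -- Both sides are derivatives at `w` of the same germ, since `G ∘ h = φ × ψ` near `w`.
  refine HasFDerivAt.unique (hdG.hasFDerivAt.comp w hd.hasFDerivAt) ?_
  refine (h2.comp w (WithLp.prodContinuousLinearEquiv 2 ℝ E₁ E₂).hasFDerivAt).congr_of_eventuallyEq
    (Filter.eventually_of_mem ((hφ.isOpen_preimage_prod hψ).mem_nhds hw) fun _ h => ?_)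
  exact hG.apply_pullbackParametrization hφ hψ h

variable [BorelSpace E₁] [BorelSpace E₂]

/-- Lebesgue measure in the parametrization by the parameters of `Y` and `Z`. -/
theorem volume_restrict_eq_map_pullbackParametrization
    (hG : IsSmoothTransformation G Ginv U Y Z) (hU : IsOpen U)
    (hφ : IsLocalParametrization Y N V φ q) (hψ : IsLocalParametrization Z N' V' ψ q')
    (hw : w ∈ WithLp.prodContinuousLinearEquiv 2 ℝ E₁ E₂ ⁻¹' (V ×ˢ V')) :
    (volume : Measure (EuclideanSpace ℝ (Fin m))).restrict (U ∩ G ⁻¹' (N ×ˢ N')) =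
      ((volume.restrict (WithLp.prodContinuousLinearEquiv 2 ℝ E₁ E₂ ⁻¹' (V ×ˢ V'))).withDensity
        fun w => ENNReal.ofReal
          (fderiv ℝ (pullbackParametrization Ginv φ ψ) w).toLinearMap.normDet).map
            (pullbackParametrization Ginv φ ψ) := by
  rw [← euclideanHausdorffMeasure_restrict_image_eq_map (hφ.isOpen_preimage_prod hψ)
    ((hG.contDiffOn_pullbackParametrization hφ hψ).of_le (by simp))
    (hG.injOn_pullbackParametrization hφ hψ)
    fun x hx => hG.fderiv_pullbackParametrization_injective hU hφ hψ hx,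
    hG.finrank_eq hU hφ hψ hw, InnerProductSpace.euclideanHausdorffMeasure_eq_volume,
    hG.image_pullbackParametrization hφ hψ]

/-- Lebesgue measure on the piece of `U` is the image under `h` of `J dw`. By the chain rule the
weight turns `J` into the product of the Jacobians of `φ` and `ψ`, and applying `G` turns `h` into
`φ × ψ`. The result is the local form of the product of the surface measures. -/
theorem map_withDensity_volumeFactor_restrict
    (hG : IsSmoothTransformation G Ginv U Y Z) (hU : IsOpen U)
    (hφ : IsLocalParametrization Y N V φ q) (hψ : IsLocalParametrization Z N' V' ψ q')
    (hw : w ∈ WithLp.prodContinuousLinearEquiv 2 ℝ E₁ E₂ ⁻¹' (V ×ˢ V')) :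
    (((volume.restrict U).withDensity fun x => ENNReal.ofReal (volumeFactor G x)).map G).restrict
        (N ×ˢ N') =
      ((volume.restrict (V ×ˢ V')).withDensity fun w =>
        ENNReal.ofReal (fderiv ℝ φ w.1).toLinearMap.normDet *
          ENNReal.ofReal (fderiv ℝ ψ w.2).toLinearMap.normDet).map (Prod.map φ ψ) := by
  set e := WithLp.prodContinuousLinearEquiv 2 ℝ E₁ E₂
  set h := pullbackParametrization Ginv φ ψ
  set D := U ∩ G ⁻¹' (N ×ˢ N')
  set W := e ⁻¹' (V ×ˢ V')
  have hWm : MeasurableSet W := (hφ.isOpen_preimage_prod hψ).measurableSet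
  have hDU : volume.restrict D ≤ volume.restrict U := Measure.restrict_mono inter_subset_left le_rfl
  set J : WithLp 2 (E₁ × E₂) → ℝ≥0∞ := fun w => ENNReal.ofReal (fderiv ℝ h w).toLinearMap.normDet
  set vF : EuclideanSpace ℝ (Fin m) → ℝ≥0∞ := fun x => ENNReal.ofReal (volumeFactor G x)
  set P : E₁ × E₂ → ℝ≥0∞ := fun w =>
        ENNReal.ofReal (fderiv ℝ φ w.1).toLinearMap.normDet *
          ENNReal.ofReal (fderiv ℝ ψ w.2).toLinearMap.normDet
  have hvol : volume.restrict D = ((volume.restrict W).withDensity J).map h :=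
    hG.volume_restrict_eq_map_pullbackParametrization hU hφ hψ hw
  have hhc := hG.contDiffOn_pullbackParametrization hφ hψ
  have hhm : AEMeasurable h (volume.restrict W) := hhc.continuousOn.aemeasurable hWm
  have hJm : AEMeasurable J (volume.restrict W) :=
    ((continuous_normDet.comp_continuousOn (hhc.continuousOn_fderiv_of_isOpen
      (hφ.isOpen_preimage_prod hψ) (by simp))).aemeasurable hWm).ennreal_ofReal
  have hvFm : AEMeasurable vF (volume.restrict D) :=
    ((hG.aemeasurable_volumeFactor hU).mono_measure hDU).ennreal_ofReal
  have hGm : AEMeasurable G ((volume.restrict U).withDensity vF) :=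
    (hG.aemeasurable hU).mono_ac (withDensity_absolutelyContinuous _ _)
  have hhJ : AEMeasurable h ((volume.restrict W).withDensity J) :=
    hhm.mono_ac (withDensity_absolutelyContinuous _ _)
  have hvFh : AEMeasurable (vF ∘ h) (volume.restrict W) := by
    refine ContinuousOn.aemeasurable ?_ hWm
    exact ENNReal.continuous_ofReal.comp_continuousOn
      ((hG.continuousOn_volumeFactor hU).comp hhc.continuousOn
        fun w hw => (hG.pullbackParametrization_mem hφ hψ hw).1)
  have hden : (volume.restrict W).withDensity (J * (vF ∘ h)) =
      (volume.restrict W).withDensity (P ∘ e) := by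
    refine withDensity_congr_ae ((ae_restrict_iff' hWm).2 (Eventually.of_forall fun w hw => ?_))
    have := hG.volumeFactor_mul_normDet hU hφ hψ hw
    simp only [J, vF, P, Pi.mul_apply, Function.comp_apply]
    rw [mul_comm, ← ENNReal.ofReal_mul (p := volumeFactor G (h w)) (Real.sqrt_nonneg _),
      this, ENNReal.ofReal_mul (LinearMap.normDet_nonneg _)]
    rfl
  have hmp : MeasurePreserving e (volume.restrict W) (volume.restrict (V ×ˢ V')) :=
    (WithLp.volume_preserving_ofLp E₁ E₂).restrict_preimage
      (hφ.isOpen_source.prod hψ.isOpen_source).measurableSet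
  have hPm : AEMeasurable P (volume.restrict (V ×ˢ V')) := by
    rw [Measure.volume_eq_prod, ← Measure.prod_restrict]
    exact (hφ.aemeasurable_normDet.comp_fst).mul (hψ.aemeasurable_normDet.comp_snd)
  have hNm : MeasurableSet (N ×ˢ N') := (hφ.isOpen_target.prod hψ.isOpen_target).measurableSet
  have hpull : (volume.restrict D).withDensity vF =
      ((volume.restrict W).withDensity (P ∘ e)).map h := by
    rw [hvol, Measure.withDensity_map hhJ (by rwa [← hvol]), ← withDensity_mul₀ hJm hvFh, hden]
  calc (((volume.restrict U).withDensity vF).map G).restrict (N ×ˢ N')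
      = ((volume.restrict D).withDensity vF).map G := by
        rw [Measure.restrict_map_of_aemeasurable hGm hNm, restrict_withDensity',
          Measure.restrict_restrict' hU.measurableSet, inter_comm]
    _ = (((volume.restrict W).withDensity (P ∘ e)).map h).map G := by rw [hpull]
    _ = ((volume.restrict W).withDensity (P ∘ e)).map (Prod.map φ ψ ∘ e) := by
        rw [AEMeasurable.map_map_of_aemeasurable]
        · refine Measure.map_congr ((withDensity_absolutelyContinuous _ _)
            ((ae_restrict_iff' hWm).2 (Eventually.of_forall fun w hw => ?_)))
          exact hG.apply_pullbackParametrization hφ hψ hw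
        · rw [← hpull]
          exact ((hG.aemeasurable hU).mono_measure hDU).mono_ac
            (withDensity_absolutelyContinuous _ _)
        · exact hhm.mono_ac (withDensity_absolutelyContinuous _ _)
    _ = (((volume.restrict W).withDensity (P ∘ e)).map e).map (Prod.map φ ψ) := by
        rw [Measure.map_map (hφ.measurable.prodMap hψ.measurable) hmp.measurable]
    _ = ((volume.restrict (V ×ˢ V')).withDensity P).map (Prod.map φ ψ) := by
        rw [← Measure.withDensity_map hmp.measurable.aemeasurable (by rwa [hmp.map_eq]), hmp.map_eq]

end IsSmoothTransformation

end Local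

end Transformation

/-! ### Uniqueness and marginals of densities. -/

section Density

variable {α β : Type*} [MeasurableSpace α] [MeasurableSpace β]

/-- Finiteness of `ν` bounds the integral of the density, which gives uniqueness although `μ` is
arbitrary. -/
theorem HasDensity.ae_eq {ν μ : Measure α} {f g : α → ℝ} [IsFiniteMeasure ν]
    (hf : HasDensity ν μ f) (hg : HasDensity ν μ g) : f =ᵐ[μ] g := by
  have hfin : ∫⁻ x, ENNReal.ofReal (f x) ∂μ ≠ ⊤ := by
    rw [← setLIntegral_univ, ← withDensity_apply _ MeasurableSet.univ]
    have := measure_ne_top ν univ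
    rwa [hf.eq_densityLaw] at this
  have heq := (withDensity_eq_iff hf.aemeasurable.ennreal_ofReal hg.aemeasurable.ennreal_ofReal
    hfin).1 (hf.eq_densityLaw.symm.trans hg.eq_densityLaw)
  filter_upwards [heq, hf.ae_nonneg, hg.ae_nonneg] with x hx h₁ h₂
  exact (ENNReal.ofReal_eq_ofReal_iff h₁ h₂).1 hx

theorem HasDensity.integrable {ν μ : Measure α} {f : α → ℝ} [IsFiniteMeasure ν]
    (hf : HasDensity ν μ f) : Integrable f μ := by
  refine ⟨hf.aemeasurable.aestronglyMeasurable, ?_⟩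
  rw [hasFiniteIntegral_iff_ofReal hf.ae_nonneg, ← setLIntegral_univ,
    ← withDensity_apply _ MeasurableSet.univ]
  have := measure_lt_top ν univ
  rwa [hf.eq_densityLaw] at this

/-- The first marginal of a measure with a density is given by the marginal density. -/
theorem HasDensity.fst {ν : Measure (α × β)} {μ : Measure α} {κ : Measure β} [SFinite μ] [SFinite κ]
    [IsFiniteMeasure ν] {f : α × β → ℝ} (hf : HasDensity ν (μ.prod κ) f) :
    HasDensity (ν.map Prod.fst) μ fun y => ∫ z, f (y, z) ∂κ := by
  have hint := hf.integrable
  have hnn := Measure.ae_ae_of_ae_prod hf.ae_nonneg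
  refine ⟨hint.integral_prod_left.aestronglyMeasurable.aemeasurable, ?_, ?_⟩
  · filter_upwards [hnn] with y hy using integral_nonneg_of_ae hy
  -- The two integrals can differ only where the slice is not integrable or is negative on a set of
  -- positive measure; such `y` form a null set.
  · have hL : ∀ᵐ y ∂μ, ∫⁻ z, ENNReal.ofReal (f (y, z)) ∂κ =
        ENNReal.ofReal (∫ z, f (y, z) ∂κ) := by
      filter_upwards [hnn, hint.prod_right_ae] with y h₁ h₂
      exact (ofReal_integral_eq_lintegral_ofReal h₂ h₁).symm
    rw [densityLaw, ← withDensity_congr_ae hL, hf.eq_densityLaw, densityLaw]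
    ext s hs
    rw [Measure.map_apply measurable_fst hs, withDensity_apply _ (measurable_fst hs),
      withDensity_apply _ hs, ← prod_univ, ← Measure.prod_restrict, Measure.restrict_univ,
      lintegral_prod]
    rw [← Measure.restrict_univ (μ := κ), Measure.prod_restrict]
    exact hf.aemeasurable.ennreal_ofReal.restrict

end Density

/-! ### The global change of variables and the main theorem. -/

section Transformation

variable {m n p k l : ℕ} {U : Set (EuclideanSpace ℝ (Fin m))}
  {Y : Set (EuclideanSpace ℝ (Fin n))} {Z : Set (EuclideanSpace ℝ (Fin p))}
  {G : EuclideanSpace ℝ (Fin m) → EuclideanSpace ℝ (Fin n) × EuclideanSpace ℝ (Fin p)}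
  {Ginv : EuclideanSpace ℝ (Fin n) × EuclideanSpace ℝ (Fin p) → EuclideanSpace ℝ (Fin m)}

theorem surfaceMeasure_prod_restrict_self
    (hY : IsEmbeddedSubmanifold k Y) (hZ : IsEmbeddedSubmanifold l Z) :
    ((surfaceMeasure k Y).prod (surfaceMeasure l Z)).restrict (Y ×ˢ Z) =
      (surfaceMeasure k Y).prod (surfaceMeasure l Z) := by
  have := hY.sFinite_surfaceMeasure
  have := hZ.sFinite_surfaceMeasure
  rw [← Measure.prod_restrict, surfaceMeasure, surfaceMeasure,
    Measure.restrict_restrict hY.measurableSet, Measure.restrict_restrict hZ.measurableSet,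
    inter_self, inter_self]

namespace IsSmoothTransformation

/-- In the chain rule for volume factors the Jacobians of `φ` and `ψ` are positive, so no factor on
the other side vanishes. -/
theorem volumeFactor_pos (hG : IsSmoothTransformation G Ginv U Y Z) (hU : IsOpen U)
    (hY : IsEmbeddedSubmanifold k Y) (hZ : IsEmbeddedSubmanifold l Z)
    {x : EuclideanSpace ℝ (Fin m)} (hx : x ∈ U) : 0 < volumeFactor G x := by
  obtain ⟨W, N, V, φ, q, hN, -, hφ⟩ := hY.exists_isLocalParametrization (hG.mapsTo hx).1
  obtain ⟨W', N', V', ψ, q', hN', -, hψ⟩ := hZ.exists_isLocalParametrization (hG.mapsTo hx).2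
  have hx' : x ∈ U ∩ G ⁻¹' (N ×ˢ N') := ⟨hx, hN, hN'⟩
  have hw := hG.pullbackChart_mem hφ hψ hx'
  have h := hG.volumeFactor_mul_normDet hU hφ hψ hw
  rw [hG.pullbackParametrization_pullbackChart hφ hψ hx'] at h
  have hpos := mul_pos (normDet_pos_of_injective (hφ.fderiv_injective hw.1))
    (normDet_pos_of_injective (hψ.fderiv_injective hw.2))
  exact pos_of_mul_pos_left (h.symm ▸ hpos) (LinearMap.normDet_nonneg _)

/-- **Change of variables**: the product of the surface measures is the image of Lebesgue measure
weighted by the volume factor. -/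
theorem map_withDensity_volumeFactor (hG : IsSmoothTransformation G Ginv U Y Z) (hU : IsOpen U)
    (hY : IsEmbeddedSubmanifold k Y) (hZ : IsEmbeddedSubmanifold l Z) :
    ((volume.restrict U).withDensity fun x => ENNReal.ofReal (volumeFactor G x)).map G =
      (surfaceMeasure k Y).prod (surfaceMeasure l Z) := by
  have := hY.sFinite_surfaceMeasure
  have := hZ.sFinite_surfaceMeasure
  have hYZ : MeasurableSet (Y ×ˢ Z) := hY.measurableSet.prod hZ.measurableSet
  refine Measure.ext_of_locally_restrict_eq (S := Y ×ˢ Z) ?_ ?_ fun y hy => ?_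
  · rw [Measure.map_apply_of_aemeasurable
      ((hG.aemeasurable hU).mono_ac (withDensity_absolutelyContinuous _ _)) hYZ.compl]
    refine withDensity_absolutelyContinuous _ _ ?_
    rw [Measure.restrict_apply' hU.measurableSet]
    rw [eq_empty_of_forall_notMem (s := G ⁻¹' (Y ×ˢ Z)ᶜ ∩ U) fun x hx => hx.1 (hG.mapsTo hx.2),
      measure_empty]
  · rw [← surfaceMeasure_prod_restrict_self hY hZ, Measure.restrict_apply hYZ.compl]
    simp
  · obtain ⟨W, N, V, φ, q, hN, hk, hφ⟩ := hY.exists_isLocalParametrization hy.1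
    obtain ⟨W', N', V', ψ, q', hN', hl, hψ⟩ := hZ.exists_isLocalParametrization hy.2
    have hx : Ginv y ∈ U ∩ G ⁻¹' (N ×ˢ N') :=
      ⟨hG.inv_mapsTo hy, by rw [mem_preimage, hG.invOn.2 hy]; exact ⟨hN, hN'⟩⟩
    refine ⟨N ×ˢ N', hφ.isOpen_target.prod hψ.isOpen_target, ⟨hN, hN'⟩, ?_⟩
    rw [hφ.surfaceMeasure_prod_restrict hψ hk hl]
    exact hG.map_withDensity_volumeFactor_restrict hU hφ hψ (hG.pullbackChart_mem hφ hψ hx)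

/-- Pulled back along `G`, the transformed density is `ρ / volumeFactor G`, and the weight in the
change of variables cancels the denominator. -/
theorem hasDensity_transformedDensity (hG : IsSmoothTransformation G Ginv U Y Z) (hU : IsOpen U)
    (hY : IsEmbeddedSubmanifold k Y) (hZ : IsEmbeddedSubmanifold l Z)
    {ρ : EuclideanSpace ℝ (Fin m) → ℝ} (hρm : AEMeasurable ρ (volume.restrict U))
    (hρ : ∀ x ∈ U, 0 ≤ ρ x) :
    HasDensity (Measure.map G (densityLaw (volume.restrict U) ρ))
      ((surfaceMeasure k Y).prod (surfaceMeasure l Z)) (transformedDensity G Ginv ρ) := by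
  have := hY.sFinite_surfaceMeasure
  have := hZ.sFinite_surfaceMeasure
  have hYZ : MeasurableSet (Y ×ˢ Z) := hY.measurableSet.prod hZ.measurableSet
  have hmap := hG.map_withDensity_volumeFactor hU hY hZ
  set H := (surfaceMeasure k Y).prod (surfaceMeasure l Z) with hH
  set μ := (volume.restrict U).withDensity fun x => ENNReal.ofReal (volumeFactor G x) with hμ
  have hμac : μ ≪ volume.restrict U := withDensity_absolutelyContinuous _ _
  have hGμ : AEMeasurable G μ := (hG.aemeasurable hU).mono_ac hμac
  have hUae : ∀ᵐ x ∂(volume.restrict U), x ∈ U := ae_restrict_mem hU.measurableSet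
  have hHr : H.restrict (Y ×ˢ Z) = H := surfaceMeasure_prod_restrict_self hY hZ
  have hHae : ∀ᵐ y ∂H, y ∈ Y ×ˢ Z := hHr ▸ ae_restrict_mem hYZ
  have hGinv : AEMeasurable Ginv H :=
    hHr ▸ hG.inv_smooth.continuousOn.aemeasurable hYZ
  -- `ρ` is only almost everywhere measurable, so its composition with `Ginv` is controlled only if
  -- `Ginv` pulls Lebesgue null sets back to null sets.
  have hac : H.map Ginv ≪ volume.restrict U := by
    rw [← hmap, AEMeasurable.map_map_of_aemeasurable (by rwa [hmap]) hGμ,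
      Measure.map_congr (g := id), Measure.map_id]
    · exact hμac
    · filter_upwards [hμac hUae] with x hx using hG.invOn.1 hx
  have hvF := hG.aemeasurable_volumeFactor hU
  have htm : AEMeasurable (transformedDensity G Ginv ρ) H :=
    ((hρm.div hvF).mono_ac hac).comp_aemeasurable hGinv
  refine ⟨htm, ?_, ?_⟩
  · filter_upwards [hHae] with y hy
    exact div_nonneg (hρ _ (hG.inv_mapsTo hy)) (Real.sqrt_nonneg _)
  · have htG : AEMeasurable (fun y => ENNReal.ofReal (transformedDensity G Ginv ρ y)) (μ.map G) := by
      rw [hmap]; exact htm.ennreal_ofReal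
    rw [densityLaw, densityLaw, ← hmap, Measure.withDensity_map hGμ htG]
    congr 1
    have hcongr : μ.withDensity ((fun y => ENNReal.ofReal (transformedDensity G Ginv ρ y)) ∘ G) =
        μ.withDensity fun x => ENNReal.ofReal (ρ x / volumeFactor G x) := by
      refine withDensity_congr_ae ?_
      filter_upwards [hμac hUae] with x hx
      simp only [Function.comp_apply, transformedDensity, hG.invOn.1 hx]
    have hmul := withDensity_mul₀ hvF.ennreal_ofReal (hρm.div hvF).ennreal_ofReal
    refine Eq.trans ?_ (hmul.trans hcongr.symm)
    refine withDensity_congr_ae ?_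
    filter_upwards [hUae] with x hx
    have hpos := hG.volumeFactor_pos hU hY hZ hx
    rw [Pi.mul_apply, Pi.div_apply, ← ENNReal.ofReal_mul hpos.le, mul_div_cancel₀ _ hpos.ne']

end IsSmoothTransformation

/-- The left side is the integrand produced by integrating against `densityLaw`. -/
theorem toReal_ofReal_smul_importanceRatio {ρ : EuclideanSpace ℝ (Fin m) → ℝ}
    {ρt : EuclideanSpace ℝ (Fin p) → ℝ} (y : EuclideanSpace ℝ (Fin n))
    {z : EuclideanSpace ℝ (Fin p)} (hz : 0 < ρt z) :
    (ENNReal.ofReal (ρt z)).toReal • importanceRatio G Ginv ρ ρt y z =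
      transformedDensity G Ginv ρ (y, z) := by
  rw [ENNReal.toReal_ofReal hz.le, smul_eq_mul, importanceRatio, transformedDensity, ← mul_div_assoc,
    mul_div_mul_left _ _ hz.ne']

end Transformation

theorem mainTheorem3 {m n p k l : ℕ}
    (U : Set (EuclideanSpace ℝ (Fin m))) (hU : IsOpen U)
    (Y : Set (EuclideanSpace ℝ (Fin n))) (hY : IsEmbeddedSubmanifold k Y)
    (Z : Set (EuclideanSpace ℝ (Fin p))) (hZ : IsEmbeddedSubmanifold l Z)
    (G : EuclideanSpace ℝ (Fin m) → EuclideanSpace ℝ (Fin n) × EuclideanSpace ℝ (Fin p))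
    (Ginv : EuclideanSpace ℝ (Fin n) × EuclideanSpace ℝ (Fin p) → EuclideanSpace ℝ (Fin m))
    (hG : IsSmoothTransformation G Ginv U Y Z)
    (ρ : EuclideanSpace ℝ (Fin m) → ℝ) (hρ : IsProbDensityOn U (volume.restrict U) ρ)
    (ρt : EuclideanSpace ℝ (Fin p) → ℝ) (hρt : IsProbDensityOn Z (surfaceMeasure l Z) ρt)
    (hρt_pos : ∀ z ∈ Z, 0 < ρt z) :
    -- the law of `(y, z) = G(x)`, `x ∼ ρ`, has the transformed density
    HasDensity (Measure.map G (densityLaw (volume.restrict U) ρ))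
      ((surfaceMeasure k Y).prod (surfaceMeasure l Z)) (transformedDensity G Ginv ρ) ∧
    -- the expectation is the marginal of that density, at every point
    (∀ y ∈ Y, ∫ z, importanceRatio G Ginv ρ ρt y z ∂(densityLaw (surfaceMeasure l Z) ρt) =
      ∫ z, transformedDensity G Ginv ρ (y, z) ∂(surfaceMeasure l Z)) ∧
    -- the expectation exists, for almost every `y`
    (∀ᵐ y ∂(surfaceMeasure k Y),
      Integrable (importanceRatio G Ginv ρ ρt y) (densityLaw (surfaceMeasure l Z) ρt)) ∧
    -- the expectation is a density of the law of the component `y` of `G(x)`, `x ∼ ρ`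
    HasDensity (Measure.map (fun x => (G x).1) (densityLaw (volume.restrict U) ρ))
      (surfaceMeasure k Y)
      (fun y => ∫ z, importanceRatio G Ginv ρ ρt y z ∂(densityLaw (surfaceMeasure l Z) ρt)) ∧
    -- every density of that law is almost everywhere equal to the expectation
    (∀ ρY : EuclideanSpace ℝ (Fin n) → ℝ,
      HasDensity (Measure.map (fun x => (G x).1) (densityLaw (volume.restrict U) ρ))
        (surfaceMeasure k Y) ρY →
      ∀ᵐ y ∂(surfaceMeasure k Y),
        ρY y = ∫ z, importanceRatio G Ginv ρ ρt y z ∂(densityLaw (surfaceMeasure l Z) ρt)) := by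
  have := hY.sFinite_surfaceMeasure
  have := hZ.sFinite_surfaceMeasure
  have := hρ.isProbabilityMeasure
  have hd := hG.hasDensity_transformedDensity hU hY hZ hρ.aemeasurable hρ.nonneg
  have hZae : ∀ᵐ z ∂(surfaceMeasure l Z), z ∈ Z := ae_restrict_mem hZ.measurableSet
  have hsmul : ∀ y, (fun z => (ENNReal.ofReal (ρt z)).toReal • importanceRatio G Ginv ρ ρt y z)
      =ᵐ[surfaceMeasure l Z] fun z => transformedDensity G Ginv ρ (y, z) := fun y => by
    filter_upwards [hZae] with z hz
    exact toReal_ofReal_smul_importanceRatio y (hρt_pos z hz)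
  -- No integrability is needed: where one integral diverges so does the other, and both are 0 by
  -- convention.
  have hE : ∀ y, ∫ z, importanceRatio G Ginv ρ ρt y z ∂(densityLaw (surfaceMeasure l Z) ρt) =
      ∫ z, transformedDensity G Ginv ρ (y, z) ∂(surfaceMeasure l Z) := fun y => by
    rw [densityLaw, integral_withDensity_eq_integral_toReal_smul₀ hρt.aemeasurable.ennreal_ofReal
      (Eventually.of_forall fun _ => ENNReal.ofReal_lt_top)]
    exact integral_congr_ae (hsmul y)
  have hGm : AEMeasurable G (densityLaw (volume.restrict U) ρ) :=
    (hG.aemeasurable hU).mono_ac (withDensity_absolutelyContinuous _ _)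
  have hmarg : HasDensity (Measure.map (fun x => (G x).1) (densityLaw (volume.restrict U) ρ))
      (surfaceMeasure k Y)
      (fun y => ∫ z, importanceRatio G Ginv ρ ρt y z ∂(densityLaw (surfaceMeasure l Z) ρt)) := by
    have h := hd.fst
    rw [AEMeasurable.map_map_of_aemeasurable measurable_fst.aemeasurable hGm] at h
    simp only [hE]
    exact h
  refine ⟨hd, fun y _ => hE y, ?_, hmarg, fun ρY hρY => hρY.ae_eq hmarg⟩
  filter_upwards [hd.integrable.prod_right_ae] with y hy
  rw [densityLaw, integrable_withDensity_iff_integrable_smul₀' hρt.aemeasurable.ennreal_ofReal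
    (Eventually.of_forall fun _ => ENNReal.ofReal_lt_top)]
  exact hy.congr (hsmul y).symm
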